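/- Fix an integer $d \ge 0$ and a real number $\alpha > 1/(d+1)$. For $n \ge 1$ let $G \sim G(n, n^{-\alpha})$ be the Erdős–Rényi random graph on $n$ vertices, in which each of the $\binom{n}{2}$ possible edges is present independently with probability $n^{-\alpha}$, and let $\Delta = \Delta(G)$ be its clique complex, whose faces are the nonempty cliques of $G$; write $\Delta \sim \Delta(n, n^{-\alpha})$. Let $\beta_{d+1}(\Delta;\mathbb{Q}) = \dim_{\mathbb{Q}} \tilde H_{d+1}(\Delta;\mathbb{Q})$ be the $(d+1)$-st rational Betti number. Then \[ \mathbb{E}\bigl(\beta_{d+1}(\Delta;\mathbb{Q})\bigr) = o(1) \qquad (n \to \infty), \] that is, $\lim_{n\to\infty} \mathbb{E}\bigl(\beta_{d+1}(\Delta;\mathbb{Q})\bigr) = 0$. -/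

import Mathlib

open MeasureTheory ProbabilityTheory Filter Asymptotics

namespace RandomClique

/-- The clique complex of a graph `G`: the faces are the nonempty finite sets of pairwise adjacent
vertices. -/
def cliqueComplex {V : Type*} (G : SimpleGraph V) : AbstractSimplicialComplex V where
  faces := {s | s.Nonempty ∧ G.IsClique (s : Set V)}
  isRelLowerSet_faces := fun _ hs =>
    ⟨hs.1, fun _ hts ht => ⟨ht, hs.2.subset (Finset.coe_subset.2 hts)⟩⟩
  singleton_mem := fun v => ⟨Finset.singleton_nonempty v, by simp⟩

section Homology

variable {V : Type*} [LinearOrder V]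

/-- The incidence sign of `s.erase v` in `s`: it is `(-1) ^ j` if `v` is the `j`-th smallest element
of `s` (counting from `j = 0`). -/
def incidence (s : Finset V) (v : V) : ℚ :=
  (-1) ^ (s.filter (fun u => u < v)).card

/-- The simplicial boundary operator on all formal rational combinations of finite sets of vertices,
`∂ {v₀ < ⋯ < vₖ} = ∑ⱼ (-1) ^ j {v₀, …, vₖ} \ {vⱼ}`.  On vertices it is the
augmentation, `∂ {v} = ∅`. -/
noncomputable def boundary : (Finset V →₀ ℚ) →ₗ[ℚ] (Finset V →₀ ℚ) :=
  Finsupp.linearCombination ℚ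
    (fun s : Finset V => ∑ v ∈ s, Finsupp.single (s.erase v) (incidence s v))

/-- The augmented rational simplicial chains of `K` on faces with `m` vertices, that is, of
dimension `m - 1`; the empty set is the only generator for `m = 0`. -/
noncomputable def chains (K : AbstractSimplicialComplex V) (m : ℕ) : Submodule ℚ (Finset V →₀ ℚ) :=
  Finsupp.supported ℚ ℚ {s : Finset V | (s = ∅ ∨ s ∈ K.faces) ∧ s.card = m}

/-- Chains on `m`-vertex faces with zero boundary. -/
noncomputable def cycles (K : AbstractSimplicialComplex V) (m : ℕ) : Submodule ℚ (Finset V →₀ ℚ) :=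
  chains K m ⊓ LinearMap.ker boundary

/-- Boundaries of chains on `(m + 1)`-vertex faces. -/
noncomputable def boundaries (K : AbstractSimplicialComplex V) (m : ℕ) :
    Submodule ℚ (Finset V →₀ ℚ) :=
  (chains K (m + 1)).map boundary

theorem incidence_swap {s : Finset V} {v w : V} (hw : w ∈ s) (h : w < v) :
    incidence s v * incidence (s.erase v) w + incidence s w * incidence (s.erase w) v = 0 := by
  have h1 : (s.erase v).filter (fun u => u < w) = s.filter (fun u => u < w) := by
    ext u
    simp only [Finset.mem_filter, Finset.mem_erase]
    constructor
    · rintro ⟨⟨_, a⟩, b⟩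
      exact ⟨a, b⟩
    · rintro ⟨a, b⟩
      exact ⟨⟨(b.trans h).ne, a⟩, b⟩
  have h2 : (s.filter (fun u => u < v)).card =
      ((s.erase w).filter (fun u => u < v)).card + 1 := by
    rw [Finset.filter_erase, Finset.card_erase_add_one (Finset.mem_filter.2 ⟨hw, h⟩)]
  unfold incidence
  rw [h1, h2]
  ring

theorem boundary_boundary (x : Finset V →₀ ℚ) : boundary (boundary x) = 0 := by
  suffices h : (boundary (V := V)).comp boundary = 0 from LinearMap.congr_fun h x
  ext1 s
  ext1
  simp only [boundary, LinearMap.comp_apply, Finsupp.lsingle_apply,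
    Finsupp.linearCombination_single, one_smul, map_sum, Finset.smul_sum, LinearMap.zero_apply,
    Finsupp.smul_single, smul_eq_mul]
  rw [Finset.sum_sigma']
  refine Finset.sum_involution (fun a _ => ⟨a.2, a.1⟩) ?_ ?_ ?_ ?_
  · rintro ⟨v, w⟩ ha
    simp only [Finset.mem_sigma, Finset.mem_erase] at ha
    obtain ⟨hv, hne, hw⟩ := ha
    simp only
    rw [Finset.erase_right_comm (a := w), ← Finsupp.single_add]
    rcases lt_or_gt_of_ne hne with h | h
    · rw [incidence_swap hw h, Finsupp.single_zero]
    · rw [add_comm, incidence_swap hv h, Finsupp.single_zero]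
  · rintro ⟨v, w⟩ ha _ heq
    simp only [Finset.mem_sigma, Finset.mem_erase] at ha
    simp only [Sigma.mk.injEq, heq_eq_eq] at heq
    exact ha.2.1 heq.1
  · rintro ⟨v, w⟩ ha
    simp only [Finset.mem_sigma, Finset.mem_erase] at ha ⊢
    exact ⟨ha.2.2, ha.2.1.symm, ha.1⟩
  · rintro ⟨v, w⟩ _
    rfl

theorem boundaries_le_cycles (K : AbstractSimplicialComplex V) (m : ℕ) :
    boundaries K m ≤ cycles K m := by
  rintro _ ⟨x, hx, rfl⟩
  refine ⟨?_, LinearMap.mem_ker.2 (boundary_boundary x)⟩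
  have hx' := (Finsupp.mem_supported ℚ x).1 hx
  rw [boundary, Finsupp.linearCombination_apply]
  refine Submodule.sum_mem _ fun s hs => Submodule.smul_mem _ _ ?_
  obtain ⟨h1, h2⟩ := hx' hs
  refine Submodule.sum_mem _ fun v hv => Finsupp.single_mem_supported ℚ _ ⟨?_, ?_⟩
  · rcases h1 with rfl | h1
    · simp at hv
    · rcases (s.erase v).eq_empty_or_nonempty with h | h
      · exact Or.inl h
      · exact Or.inr ((K.isRelLowerSet_faces h1).2 (Finset.erase_subset _ _) h)
  · rw [Finset.card_erase_of_mem hv, h2, Nat.add_sub_cancel]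

/-- The reduced rational simplicial homology of `K` in dimension `i` (faces of dimension `i` have
`i + 1` vertices): cycles modulo boundaries. -/
abbrev ReducedHomology (K : AbstractSimplicialComplex V) (i : ℕ) : Type _ :=
  cycles K (i + 1) ⧸ (boundaries K (i + 1)).submoduleOf (cycles K (i + 1))

/-- The `i`-th rational Betti number of a complex on finitely many vertices: the dimension of its
reduced rational homology in dimension `i`. -/
noncomputable def betti [Finite V] (K : AbstractSimplicialComplex V) (i : ℕ) : ℕ :=
  Module.finrank ℚ (ReducedHomology K i)

end Homology

end RandomClique

/-!
Write `k = d + 1`, so that `α * k > 1`. The graph is sparse enough that every vertex set of bounded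
size spanning at least `k` edges per vertex is rare: the expected number of such sets with `m ≥ 1`
vertices is `O (n ^ (m - α * k * m))`. The proof bounds the Betti number of the clique complex by
counts of such sets.

A `k`-dimensional cycle is first cut into small pieces. Starting from a face of the cycle, keep
adding vertices joined to `k` vertices already present; each step adds one vertex and `k` edges. If
the process stops at a set `S` before reaching a fixed size `N`, then the part of the cycle inside
`S` is itself a cycle and can be split off (`exists_subcycle`). If it reaches size `N`, the graph
contains `N` vertices spanning `k * N - k * (k + 1)` edges. This is so unlikely for large `N` that
one can afford the trivial bound `n ^ (k + 1)` on the Betti number (`exists_threshold`).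

A cycle on a small set `S` is then pushed into a dense subset of `S`. A vertex `v` with fewer than
`2 * k` neighbours in `S` has a link with no homology in dimension `k - 1`, because a clique complex
with nonzero homology in that dimension has at least `2 * k` vertices (`acyclicOn_of_card_lt`).
Therefore the cycle is homologous to one avoiding `v` (`AcyclicOn.exists_erase`). When no such vertex
is left, either the cycle is zero or the remaining vertices span at least `k` edges each on average
(`exists_sub_boundary_mem_of_card_lt`). Hence the homology is generated by faces in small dense sets, which gives the
deterministic inequality `betti_cliqueComplex_le`; taking expectations gives `integral_betti_le`.
-/

namespace RandomClique

/-! ### Cones and the boundary operator -/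

section Homology

variable {V : Type*}

theorem eq_zero_of_mem_supported_of_add_eq_zero {ι : Type*} {A : Set ι} {x y : ι →₀ ℚ}
    (hx : x ∈ Finsupp.supported ℚ ℚ A) (hy : y ∈ Finsupp.supported ℚ ℚ Aᶜ) (h : x + y = 0) :
    x = 0 := by
  have hx' : x ∈ Finsupp.supported ℚ ℚ Aᶜ := by
    rw [eq_neg_of_add_eq_zero_left h]
    exact neg_mem hy
  have := (Finsupp.disjoint_supported_supported (M := ℚ) (R := ℚ)
    (disjoint_compl_right (a := A))).le_bot ⟨hx, hx'⟩
  simpa using this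

theorem linearCombination_mem_supported {ι κ : Type*} {A : Set ι} {f : ι → κ →₀ ℚ}
    {A' : Set κ} (h : ∀ s ∈ A, f s ∈ Finsupp.supported ℚ ℚ A') {x : ι →₀ ℚ}
    (hx : x ∈ Finsupp.supported ℚ ℚ A) :
    Finsupp.linearCombination ℚ f x ∈ Finsupp.supported ℚ ℚ A' := by
  rw [Finsupp.linearCombination_apply]
  exact Submodule.sum_mem _ fun s hs => Submodule.smul_mem _ _
    (h s ((Finsupp.mem_supported ℚ x).1 hx hs))

/-- The chains on `m`-vertex cliques of `G` all of whose vertices lie in `W`. -/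
noncomputable def cliqueChains (G : SimpleGraph V) (W : Finset V) (m : ℕ) :
    Submodule ℚ (Finset V →₀ ℚ) :=
  Finsupp.supported ℚ ℚ {s : Finset V | s ⊆ W ∧ G.IsClique (s : Set V) ∧ s.card = m}

theorem chains_cliqueComplex [Fintype V] (G : SimpleGraph V) (m : ℕ) :
    chains (cliqueComplex G) m = cliqueChains G Finset.univ m := by
  unfold chains cliqueChains
  congr 1
  ext s
  simp only [Set.mem_ofPred_eq, Finset.subset_univ, true_and]
  refine and_congr_left fun _ => ⟨?_, fun h => ?_⟩
  · rintro (rfl | h)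
    · simp
    · exact h.2
  · rcases s.eq_empty_or_nonempty with h' | h'
    · exact Or.inl h'
    · exact Or.inr ⟨h', h⟩

theorem cliqueChains_mono (G : SimpleGraph V) {W W' : Finset V} (h : W ⊆ W') (m : ℕ) :
    cliqueChains G W m ≤ cliqueChains G W' m :=
  Finsupp.supported_mono fun _ hs => ⟨hs.1.trans h, hs.2⟩

theorem cliqueChains_empty (G : SimpleGraph V) (m : ℕ) : cliqueChains G ∅ (m + 1) = ⊥ := by
  rw [cliqueChains, ← Finsupp.supported_empty]
  congr 1
  ext s
  simp only [Set.mem_ofPred_eq, Set.mem_empty_iff_false, iff_false, Finset.subset_empty]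
  rintro ⟨rfl, -, h⟩
  simp at h

variable [LinearOrder V]

theorem boundary_mem_supported {A A' : Set (Finset V)}
    (h : ∀ s ∈ A, ∀ v ∈ s, s.erase v ∈ A') {x : Finset V →₀ ℚ}
    (hx : x ∈ Finsupp.supported ℚ ℚ A) : boundary x ∈ Finsupp.supported ℚ ℚ A' :=
  linearCombination_mem_supported (fun s hs => Submodule.sum_mem _ fun v hv =>
    Finsupp.single_mem_supported ℚ _ (h s hs v hv)) hx

theorem incidence_mul_self (s : Finset V) (v : V) : incidence s v * incidence s v = 1 := by
  unfold incidence
  rw [← mul_pow]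
  simp

/-- The cone operator with apex `v`, which sends a face `s` to `s ∪ {v}` with the sign that makes
`s` occur in the boundary of the result with coefficient `1`. It is used only on faces that do not
contain `v`. -/
noncomputable def cone (v : V) : (Finset V →₀ ℚ) →ₗ[ℚ] (Finset V →₀ ℚ) :=
  Finsupp.linearCombination ℚ
    (fun s : Finset V => Finsupp.single (insert v s) (incidence (insert v s) v))

theorem cone_mem_supported (v : V) {A A' : Set (Finset V)}
    (h : ∀ s ∈ A, insert v s ∈ A') {x : Finset V →₀ ℚ}
    (hx : x ∈ Finsupp.supported ℚ ℚ A) : cone v x ∈ Finsupp.supported ℚ ℚ A' :=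
  linearCombination_mem_supported (fun s hs => Finsupp.single_mem_supported ℚ _ (h s hs)) hx

theorem incidence_mul_incidence {s : Finset V} {v w : V} (hv : v ∈ s) (hw : w ∈ s) (h : w ≠ v) :
    incidence s v * incidence s w = -(incidence (s.erase v) w * incidence (s.erase w) v) := by
  have key : incidence s v * incidence (s.erase v) w +
      incidence s w * incidence (s.erase w) v = 0 := by
    rcases lt_or_gt_of_ne h with h | h
    · exact incidence_swap hw h
    · rw [add_comm]; exact incidence_swap hv h
  have e1 := incidence_mul_self s v
  have e2 := incidence_mul_self (s.erase w) v
  linear_combination incidence s v * incidence (s.erase w) v * key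
    - incidence s v * incidence s w * e2 - incidence (s.erase v) w * incidence (s.erase w) v * e1

/-- On chains whose faces avoid `v`, coning with apex `v` is a chain homotopy from the identity
to zero. -/
theorem boundary_cone {v : V} {x : Finset V →₀ ℚ}
    (hx : x ∈ Finsupp.supported ℚ ℚ {s : Finset V | v ∉ s}) :
    boundary (cone v x) = x - cone v (boundary x) := by
  rw [Finsupp.supported_eq_span_single] at hx
  induction hx using Submodule.span_induction with
  | zero => simp
  | add x y _ _ hx hy => simp only [map_add, hx, hy]; abel
  | smul a x _ hx => simp only [map_smul, hx, smul_sub]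
  | mem x hx =>
    obtain ⟨s, hs, rfl⟩ := hx
    simp only [Set.mem_ofPred_eq] at hs
    simp only [cone, boundary, Finsupp.linearCombination_single, one_smul, map_sum,
      Finsupp.smul_single, smul_eq_mul, Finset.smul_sum]
    rw [Finset.sum_insert hs, Finset.erase_insert hs, incidence_mul_self, sub_eq_add_neg,
      ← Finset.sum_neg_distrib]
    congr 1
    refine Finset.sum_congr rfl fun w hw => ?_
    have hwv : w ≠ v := fun h => hs (h ▸ hw)
    rw [Finset.erase_insert_of_ne hwv.symm, ← Finsupp.single_neg,
      incidence_mul_incidence (Finset.mem_insert_self v s) (Finset.mem_insert_of_mem hw) hwv,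
      Finset.erase_insert hs, Finset.erase_insert_of_ne hwv.symm]

/-! ### Links and the removal of vertices -/

section Link

variable (G : SimpleGraph V)

theorem cone_mem_cliqueChains {W U : Finset V} {v : V} (hv : v ∈ W) (hU : U ⊆ W)
    (hadj : ∀ u ∈ U, G.Adj v u) {m : ℕ} {x : Finset V →₀ ℚ} (hx : x ∈ cliqueChains G U m) :
    cone v x ∈ cliqueChains G W (m + 1) := by
  refine cone_mem_supported v (fun s hs => ?_) hx
  obtain ⟨h1, h2, h3⟩ := hs
  have hvs : v ∉ s := fun h => (hadj v (h1 h)).ne rfl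
  refine ⟨Finset.insert_subset hv (h1.trans hU), ?_, by rw [Finset.card_insert_of_notMem hvs, h3]⟩
  rw [Finset.coe_insert, SimpleGraph.isClique_insert]
  exact ⟨h2, fun u hu _ => hadj u (h1 hu)⟩

/-- Every cycle on `m`-vertex cliques in `W` bounds a chain on cliques in `W`, that is, the reduced
homology of the clique complex of `G[W]` vanishes in dimension `m - 1`. -/
def AcyclicOn (W : Finset V) (m : ℕ) : Prop :=
  ∀ z ∈ cliqueChains G W m, boundary z = 0 → ∃ c ∈ cliqueChains G W (m + 1), boundary c = z

variable [DecidableRel G.Adj]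

/-- A cycle `z` on cliques in `W` splits as `cone v a + b`, where `a` lives on the link of `v` and
`b` on the cliques avoiding `v`; comparing the faces without `v` in `∂ z = 0` gives `a = -∂ b`. -/
theorem exists_cone_add {W : Finset V} {v : V} {m : ℕ} {z : Finset V →₀ ℚ}
    (hz : z ∈ cliqueChains G W (m + 1)) (h0 : boundary z = 0) :
    ∃ a ∈ cliqueChains G (W.filter (G.Adj v)) m, ∃ b ∈ cliqueChains G (W.erase v) (m + 1),
      z = cone v a + b ∧ a = -boundary b := by
  have hle : cliqueChains G W (m + 1) ≤
      (cliqueChains G (W.filter (G.Adj v)) m).map (cone v) ⊔ cliqueChains G (W.erase v) (m + 1) := by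
    rw [cliqueChains, Finsupp.supported_eq_span_single, Submodule.span_le]
    rintro _ ⟨s, ⟨h1, h2, h3⟩, rfl⟩
    by_cases hv : v ∈ s
    · refine Submodule.mem_sup_left ⟨Finsupp.single (s.erase v) (incidence s v),
        Finsupp.single_mem_supported ℚ _ ⟨fun u hu => ?_, ?_, ?_⟩, ?_⟩
      · have hu' := Finset.mem_of_mem_erase hu
        exact Finset.mem_filter.2 ⟨h1 hu', h2 hv hu' (Finset.ne_of_mem_erase hu).symm⟩
      · exact h2.subset (Finset.coe_subset.2 (Finset.erase_subset _ _))
      · rw [Finset.card_erase_of_mem hv, h3, Nat.add_sub_cancel]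
      · rw [cone, Finsupp.linearCombination_single, Finset.insert_erase hv, Finsupp.smul_single,
          smul_eq_mul, incidence_mul_self]
    · exact Submodule.mem_sup_right
        (Finsupp.single_mem_supported ℚ _ ⟨Finset.subset_erase.2 ⟨h1, hv⟩, h2, h3⟩)
  obtain ⟨_, ⟨a, ha, rfl⟩, b, hb, rfl⟩ := Submodule.mem_sup.1 (hle hz)
  refine ⟨a, ha, b, hb, rfl, ?_⟩
  have hav : a ∈ Finsupp.supported ℚ ℚ {s : Finset V | v ∉ s} :=
    Finsupp.supported_mono (fun s hs h => by simpa using hs.1 h) ha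
  have hbv : b ∈ Finsupp.supported ℚ ℚ {s : Finset V | v ∉ s} :=
    Finsupp.supported_mono (fun s hs h => by simpa using hs.1 h) hb
  have hbd : ∀ {x : Finset V →₀ ℚ}, x ∈ Finsupp.supported ℚ ℚ {s : Finset V | v ∉ s} →
      boundary x ∈ Finsupp.supported ℚ ℚ {s : Finset V | v ∉ s} := fun hx =>
    boundary_mem_supported (A := {s : Finset V | v ∉ s}) (A' := {s : Finset V | v ∉ s})
      (fun s hs w _ h => hs (Finset.mem_of_mem_erase h)) hx
  refine eq_neg_of_add_eq_zero_left (eq_zero_of_mem_supported_of_add_eq_zero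
    (y := -cone v (boundary a)) (add_mem hav (hbd hbv)) (neg_mem ?_) ?_)
  · exact cone_mem_supported v (fun s _ => by simp) (hbd hav)
  · rw [map_add, boundary_cone hav] at h0
    rw [← h0]
    abel

/-- If the link of `v` in `W` is acyclic, then every cycle in `W` one dimension higher can be
pushed off `v` by a boundary. -/
theorem AcyclicOn.exists_erase {W : Finset V} {v : V} (hv : v ∈ W) {m : ℕ}
    (hlink : AcyclicOn G (W.filter (G.Adj v)) m) {z : Finset V →₀ ℚ}
    (hz : z ∈ cliqueChains G W (m + 1)) (h0 : boundary z = 0) :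
    ∃ z' ∈ cliqueChains G (W.erase v) (m + 1), ∃ c ∈ cliqueChains G W (m + 2),
      z = z' + boundary c ∧ boundary z' = 0 := by
  obtain ⟨a, ha, b, hb, rfl, hab⟩ := exists_cone_add G (v := v) hz h0
  obtain ⟨c, hc, rfl⟩ := hlink a ha (by rw [hab, map_neg, boundary_boundary, neg_zero])
  have hcv : c ∈ Finsupp.supported ℚ ℚ {s : Finset V | v ∉ s} :=
    Finsupp.supported_mono (fun s hs h => by simpa using hs.1 h) hc
  have hsub : W.filter (G.Adj v) ⊆ W.erase v := fun u hu =>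
    Finset.mem_erase.2 ⟨(Finset.mem_filter.1 hu).2.ne', (Finset.mem_filter.1 hu).1⟩
  have hz' : cone v (boundary c) + b = (b + c) + boundary (-cone v c) := by
    rw [map_neg, boundary_cone hcv]
    abel
  refine ⟨b + c, add_mem hb (cliqueChains_mono G hsub _ hc), -cone v c,
    neg_mem (cone_mem_cliqueChains G hv (Finset.filter_subset _ _)
      (fun u hu => (Finset.mem_filter.1 hu).2) hc), hz', ?_⟩
  rw [hz', map_add, boundary_boundary, add_zero] at h0
  exact h0

/-- A clique complex on fewer than `2 * m` vertices has no homology in dimension `m - 1`. Either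
some vertex is a cone point, or some vertex `v` has a non-neighbour; then the link of `v` has at
least two vertices fewer, so `v` can be removed. -/
theorem acyclicOn_of_card_lt (W : Finset V) (m : ℕ) (hW : W.card < 2 * m) : AcyclicOn G W m := by
  induction hn : W.card using Nat.strong_induction_on generalizing W m with
  | _ n ih =>
  subst hn
  intro z hz h0
  obtain _ | m := m
  · omega
  rcases W.eq_empty_or_nonempty with rfl | ⟨v, hv⟩
  · rw [cliqueChains_empty, Submodule.mem_bot] at hz
    exact ⟨0, zero_mem _, by rw [hz, map_zero]⟩
  by_cases hcone : ∀ u ∈ W.erase v, G.Adj v u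
  · obtain ⟨a, ha, b, hb, rfl, hab⟩ := exists_cone_add G (v := v) hz h0
    have hbv : b ∈ Finsupp.supported ℚ ℚ {s : Finset V | v ∉ s} :=
      Finsupp.supported_mono (fun s hs h => by simpa using hs.1 h) hb
    refine ⟨cone v b, cone_mem_cliqueChains G hv (Finset.erase_subset _ _) hcone hb, ?_⟩
    rw [boundary_cone hbv, hab, map_neg]
    abel
  · push Not at hcone
    obtain ⟨w, hw, hvw⟩ := hcone
    have hlt : (W.erase v).card + 1 = W.card := Finset.card_erase_add_one hv
    have hsub : W.filter (G.Adj v) ⊆ (W.erase v).erase w := fun u hu => by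
      obtain ⟨h1, h2⟩ := Finset.mem_filter.1 hu
      exact Finset.mem_erase.2 ⟨fun h => hvw (h ▸ h2), Finset.mem_erase.2 ⟨h2.ne', h1⟩⟩
    have hcard := Finset.card_le_card hsub
    have hlt' := Finset.card_erase_add_one hw
    obtain ⟨z', hz', c, hc, rfl, hz0⟩ := AcyclicOn.exists_erase G hv
      (ih _ (by omega) (W.filter (G.Adj v)) m (by omega) rfl) hz h0
    obtain ⟨c', hc', rfl⟩ := ih _ (by omega) (W.erase v) (m + 1) (by omega) rfl z' hz' hz0
    exact ⟨c' + c, add_mem (cliqueChains_mono G (Finset.erase_subset _ _) _ hc') hc, map_add ..⟩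

end Link

end Homology

/-! ### Cycles and dense vertex sets -/

section Density

variable {V : Type*} (G : SimpleGraph V) [DecidableRel G.Adj]

/-- The edges of `G` with both ends in `T`. -/
def edgesIn (T : Finset V) : Finset (Sym2 V) :=
  T.sym2.filter (· ∈ G.edgeSet)

theorem mk_mem_edgesIn {T : Finset V} {u v : V} :
    s(u, v) ∈ edgesIn G T ↔ (u ∈ T ∧ v ∈ T) ∧ G.Adj u v := by
  simp [edgesIn]

variable [LinearOrder V]

theorem mul_card_le_card_edgesIn {T : Finset V} {k : ℕ}
    (h : ∀ v ∈ T, 2 * k ≤ (T.filter (G.Adj v)).card) : k * T.card ≤ (edgesIn G T).card := by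
  let D : Finset (Σ _ : V, V) := T.sigma fun v => T.filter (G.Adj v)
  have h1 : T.card * (2 * k) ≤ D.card := by
    rw [Finset.card_sigma]
    exact Finset.card_nsmul_le_sum _ _ _ h
  -- Each edge comes from at most two ordered pairs.
  have h2 : D.card ≤ 2 * (D.image fun a => s(a.1, a.2)).card := by
    refine Finset.card_le_mul_card_image _ _ fun e _ => ?_
    induction e using Sym2.ind with
    | _ u v =>
    refine (Finset.card_le_card (t := {⟨u, v⟩, ⟨v, u⟩}) fun a ha => ?_).trans Finset.card_le_two
    obtain ⟨x, y⟩ := a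
    rcases Sym2.eq_iff.1 (Finset.mem_filter.1 ha).2 with ⟨rfl, rfl⟩ | ⟨rfl, rfl⟩ <;> simp
  have h3 : (D.image fun a => s(a.1, a.2)) ⊆ edgesIn G T := by
    intro e he
    obtain ⟨⟨u, v⟩, ha, rfl⟩ := Finset.mem_image.1 he
    simp only [D, Finset.mem_sigma, Finset.mem_filter] at ha
    exact (mk_mem_edgesIn G).2 ⟨⟨ha.1, ha.2.1⟩, ha.2.2⟩
  have h4 := Finset.card_le_card h3
  nlinarith

theorem card_edgesIn_insert {S τ : Finset V} {v : V} (hv : v ∉ S) (hτ : τ ⊆ S)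
    (hadj : ∀ u ∈ τ, G.Adj v u) :
    (edgesIn G S).card + τ.card ≤ (edgesIn G (insert v S)).card := by
  have hinj : Function.Injective fun u => s(v, u) := fun a b h => Sym2.congr_right.1 h
  rw [← Finset.card_image_of_injective τ hinj, ← Finset.card_union_of_disjoint]
  · refine Finset.card_le_card (Finset.union_subset (fun e he => ?_) fun e he => ?_)
    · induction e using Sym2.ind with
      | _ a b =>
      rw [mk_mem_edgesIn] at he ⊢
      exact ⟨⟨Finset.mem_insert_of_mem he.1.1, Finset.mem_insert_of_mem he.1.2⟩, he.2⟩
    · obtain ⟨u, hu, rfl⟩ := Finset.mem_image.1 he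
      exact (mk_mem_edgesIn G).2 ⟨⟨Finset.mem_insert_self _ _,
        Finset.mem_insert_of_mem (hτ hu)⟩, hadj u hu⟩
  · refine Finset.disjoint_left.2 fun e he he' => ?_
    obtain ⟨u, hu, rfl⟩ := Finset.mem_image.1 he'
    exact hv ((mk_mem_edgesIn G).1 he).1.1

/-- The vertex sets of fewer than `N` vertices that span at least `k` edges per vertex. -/
def denseSets (k N : ℕ) : Set (Finset V) :=
  {T | T.Nonempty ∧ T.card < N ∧ k * T.card ≤ (edgesIn G T).card}

/-- Removing vertices of degree less than `2 * k` one at a time, a `k`-dimensional cycle on fewer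
than `N` vertices is pushed by boundaries into a set in which all degrees are at least `2 * k`. -/
theorem exists_sub_boundary_mem_of_card_lt {k N : ℕ} (S : Finset V) (hS : S.card < N) {z : Finset V →₀ ℚ}
    (hz : z ∈ cliqueChains G S (k + 1)) (h0 : boundary z = 0) :
    ∃ c, (∃ W, c ∈ cliqueChains G W (k + 2)) ∧
      z - boundary c ∈ Finsupp.supported ℚ ℚ {s | ∃ T ∈ denseSets G k N, s ⊆ T} := by
  induction hn : S.card generalizing S z with
  | zero =>
    rw [Finset.card_eq_zero.1 hn, cliqueChains_empty, Submodule.mem_bot] at hz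
    refine ⟨0, ⟨∅, zero_mem _⟩, ?_⟩
    rw [hz, map_zero, sub_zero]
    exact zero_mem _
  | succ n ih =>
    by_cases h : ∀ v ∈ S, 2 * k ≤ (S.filter (G.Adj v)).card
    · refine ⟨0, ⟨∅, zero_mem _⟩, ?_⟩
      rw [map_zero, sub_zero]
      exact Finsupp.supported_mono (t := {s | ∃ T ∈ denseSets G k N, s ⊆ T})
        (fun s hs => ⟨S, ⟨Finset.card_pos.1 (by omega), hS, mul_card_le_card_edgesIn G h⟩, hs.1⟩) hz
    · push Not at h
      obtain ⟨v, hv, hlt⟩ := h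
      obtain ⟨z', hz', c, hc, rfl, hz0⟩ := AcyclicOn.exists_erase G hv
        (acyclicOn_of_card_lt G _ k hlt) hz h0
      have hcard := Finset.card_erase_add_one hv
      obtain ⟨c', ⟨W, hc'⟩, h'⟩ := ih (S.erase v) (by omega) hz' hz0 (by omega)
      refine ⟨c' + c, ⟨W ∪ S, add_mem (cliqueChains_mono G Finset.subset_union_left _ hc')
        (cliqueChains_mono G Finset.subset_union_right _ hc)⟩, ?_⟩
      rw [map_add, add_sub_add_right_eq_sub]
      exact h'

variable [Fintype V]

/-- A face `σ` of a `k`-dimensional cycle `z` lies in a set `S` of fewer than `N` vertices that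
carries a whole subcycle of `z`: take `S ⊇ σ` maximal with about `k` edges per vertex, so that no
vertex outside `S` completes `k` vertices of `S` to a face. -/
theorem exists_subcycle {k N : ℕ} (hkN : k + 1 ≤ N)
    (hsparse : ¬∃ T : Finset V, T.card = N ∧ k * N ≤ (edgesIn G T).card + k * (k + 1))
    {z : Finset V →₀ ℚ} (hz : z ∈ cliqueChains G Finset.univ (k + 1)) (h0 : boundary z = 0)
    {σ : Finset V} (hσ : σ ∈ z.support) :
    ∃ S : Finset V, S.card < N ∧ σ ⊆ S ∧ boundary (z.filter (· ⊆ S)) = 0 := by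
  have hz' := (Finsupp.mem_supported ℚ z).1 hz
  -- The slack `k * (k + 1)` lets the face `σ` itself belong to the family.
  let 𝒮 : Finset (Finset V) := Finset.univ.filter fun S =>
    σ ⊆ S ∧ S.card ≤ N ∧ k * S.card ≤ (edgesIn G S).card + k * (k + 1)
  have hne : 𝒮.Nonempty := by
    refine ⟨σ, Finset.mem_filter.2 ⟨Finset.mem_univ _, subset_rfl, ?_, ?_⟩⟩
    · rw [(hz' hσ).2.2]; exact hkN
    · rw [(hz' hσ).2.2]; exact Nat.le_add_left _ _
  obtain ⟨S, hS, hmax⟩ := Finset.exists_max_image 𝒮 Finset.card hne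
  obtain ⟨-, hσS, hSN, hSe⟩ := Finset.mem_filter.1 hS
  have hlt : S.card < N := lt_of_le_of_ne hSN fun h => hsparse ⟨S, h, h ▸ hSe⟩
  refine ⟨S, hlt, hσS, ?_⟩
  -- The parts of `z` inside and outside `S` have boundaries with disjoint supports.
  refine eq_zero_of_mem_supported_of_add_eq_zero (A := {τ : Finset V | τ ⊆ S})
    (y := boundary (z.filter (¬ · ⊆ S))) ?_ ?_ ?_
  · refine boundary_mem_supported (A := {τ : Finset V | τ ⊆ S})
      (fun s hs v _ => (Finset.erase_subset _ _).trans hs) ?_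
    exact (Finsupp.mem_supported ℚ _).2 fun s hs => by
      rw [Finset.mem_coe, Finsupp.support_filter, Finset.mem_filter] at hs
      exact hs.2
  · refine boundary_mem_supported (A := {s : Finset V | s ∈ z.support ∧ ¬ s ⊆ S})
      (A' := {τ : Finset V | τ ⊆ S}ᶜ)
      (fun s hs v hv (hsub : s.erase v ⊆ S) => ?_) ?_
    · obtain ⟨-, hcl, hcard⟩ := hz' hs.1
      have hvS : v ∉ S := fun h => hs.2 fun u hu => by
        by_cases huv : u = v
        · exact huv ▸ h
        · exact hsub (Finset.mem_erase.2 ⟨huv, hu⟩)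
      have hedge := card_edgesIn_insert G hvS hsub fun u hu =>
        hcl hv (Finset.mem_of_mem_erase hu) (Finset.ne_of_mem_erase hu).symm
      have hins := Finset.card_insert_of_notMem hvS
      rw [Finset.card_erase_of_mem hv, hcard, Nat.add_sub_cancel] at hedge
      have := hmax (insert v S) (Finset.mem_filter.2 ⟨Finset.mem_univ _,
        hσS.trans (Finset.subset_insert _ _), by omega, by rw [hins, mul_add_one]; omega⟩)
      omega
    · exact (Finsupp.mem_supported ℚ _).2 fun s hs => by
        rw [Finset.mem_coe, Finsupp.support_filter, Finset.mem_filter] at hs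
        exact hs
  · rw [← map_add, Finsupp.filter_add_filter_not, h0]

/-- If no `N` vertices span almost `k` edges per vertex, then the homology of the clique complex in
dimension `k` is carried by the small dense vertex sets. -/
theorem cycles_le_boundaries_sup {k N : ℕ} (hkN : k + 1 ≤ N)
    (hsparse : ¬∃ T : Finset V, T.card = N ∧ k * N ≤ (edgesIn G T).card + k * (k + 1)) :
    cycles (cliqueComplex G) (k + 1) ≤ boundaries (cliqueComplex G) (k + 1) ⊔
      Finsupp.supported ℚ ℚ {s | ∃ T ∈ denseSets G k N, s ⊆ T} := by
  rintro z ⟨hz, h0⟩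
  rw [chains_cliqueComplex] at hz
  replace h0 := LinearMap.mem_ker.1 h0
  rw [boundaries, chains_cliqueComplex]
  induction hn : z.support.card using Nat.strong_induction_on generalizing z with
  | _ n ih =>
  rcases z.support.eq_empty_or_nonempty with he | ⟨σ, hσ⟩
  · rw [Finsupp.support_eq_empty.1 he]
    exact zero_mem _
  obtain ⟨S, hSN, hσS, hS0⟩ := exists_subcycle G hkN hsparse hz h0 hσ
  have hz' := (Finsupp.mem_supported ℚ z).1 hz
  have hsum := Finsupp.filter_add_filter_not z (· ⊆ S)
  rw [← hsum]
  refine add_mem ?_ (ih _ ?_ ?_ ?_ rfl)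
  · obtain ⟨c, ⟨W, hc⟩, hcz⟩ := exists_sub_boundary_mem_of_card_lt G (k := k) S hSN
      (z := z.filter (· ⊆ S))
      ((Finsupp.mem_supported ℚ _).2 fun s hs => by
        rw [Finset.mem_coe, Finsupp.support_filter, Finset.mem_filter] at hs
        exact ⟨hs.2, (hz' hs.1).2⟩) hS0
    rw [← add_sub_cancel (boundary c) (z.filter (· ⊆ S))]
    exact Submodule.add_mem_sup ⟨c, cliqueChains_mono G (Finset.subset_univ W) _ hc, rfl⟩ hcz
  · rw [← hn, Finsupp.support_filter]
    exact Finset.card_lt_card (Finset.filter_ssubset.2 ⟨σ, hσ, by simpa using hσS⟩)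
  · exact (Finsupp.mem_supported ℚ _).2 fun s hs => by
      rw [Finset.mem_coe, Finsupp.support_filter, Finset.mem_filter] at hs
      exact hz' hs.1
  · rw [← hsum, map_add, hS0, zero_add] at h0
    exact h0

end Density

/-! ### The deterministic bound on the Betti number -/

section Betti

variable {V : Type*} [LinearOrder V] [Fintype V]

theorem finrank_supported {ι : Type*} (A : Finset ι) :
    Module.finrank ℚ (Finsupp.supported ℚ ℚ (A : Set ι)) = A.card := by
  rw [(Finsupp.supportedEquivFinsupp (A : Set ι)).finrank_eq]
  simp

theorem betti_le_finrank_of_le (K : AbstractSimplicialComplex V) (i : ℕ)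
    (W : Submodule ℚ (Finset V →₀ ℚ)) (h : cycles K (i + 1) ≤ boundaries K (i + 1) ⊔ W) :
    betti K i ≤ Module.finrank ℚ W := by
  have h1 : Module.finrank ℚ (ReducedHomology K i) + _ = _ :=
    Submodule.finrank_quotient_add_finrank ((boundaries K (i + 1)).submoduleOf (cycles K (i + 1)))
  have h2 : Module.finrank ℚ ((boundaries K (i + 1)).submoduleOf (cycles K (i + 1))) =
      Module.finrank ℚ (boundaries K (i + 1)) :=
    (Submodule.submoduleOfEquivOfLe (boundaries_le_cycles K (i + 1))).finrank_eq
  have h3 := Submodule.finrank_mono h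
  have h4 := Submodule.finrank_add_le_finrank_add_finrank (boundaries K (i + 1)) W
  rw [betti]
  omega

theorem betti_le_choose (K : AbstractSimplicialComplex V) (i : ℕ) :
    betti K i ≤ (Fintype.card V).choose (i + 1) := by
  rw [← Finset.card_univ, ← Finset.card_powersetCard, ← finrank_supported]
  refine betti_le_finrank_of_le K i _ (inf_le_left.trans (le_sup_of_le_right ?_))
  exact Finsupp.supported_mono fun s hs =>
    Finset.mem_coe.2 (Finset.mem_powersetCard.2 ⟨Finset.subset_univ _, hs.2⟩)

/-- The deterministic bound: small dense sets contribute at most their number of faces, and a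
single large set that is almost dense is charged the trivial bound on the Betti number. -/
theorem betti_cliqueComplex_le (G : SimpleGraph V) [DecidableRel G.Adj] {k N : ℕ}
    (hkN : k + 1 ≤ N) :
    betti (cliqueComplex G) k ≤
      ∑ m ∈ Finset.Ico 1 N, ∑ T ∈ (Finset.univ : Finset V).powersetCard m,
        (if k * m ≤ (edgesIn G T).card then 2 ^ m else 0) +
      ∑ T ∈ (Finset.univ : Finset V).powersetCard N,
        (if k * N - k * (k + 1) ≤ (edgesIn G T).card then Fintype.card V ^ (k + 1) else 0) := by
  by_cases h : ∃ T : Finset V, T.card = N ∧ k * N ≤ (edgesIn G T).card + k * (k + 1)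
  · obtain ⟨T, hT, hTe⟩ := h
    refine le_add_of_nonneg_of_le (Nat.zero_le _) ?_
    calc betti (cliqueComplex G) k ≤ Fintype.card V ^ (k + 1) :=
          (betti_le_choose _ k).trans (Nat.choose_le_pow _ _)
      _ = if k * N - k * (k + 1) ≤ (edgesIn G T).card then Fintype.card V ^ (k + 1) else 0 :=
          (if_pos (by omega)).symm
      _ ≤ _ := Finset.single_le_sum (f := fun T =>
            if k * N - k * (k + 1) ≤ (edgesIn G T).card then Fintype.card V ^ (k + 1) else 0)
          (fun _ _ => Nat.zero_le _)
          (Finset.mem_powersetCard.2 ⟨Finset.subset_univ _, hT⟩)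
  · refine le_add_of_le_of_nonneg ?_ (Nat.zero_le _)
    let A : Finset (Finset V) := (Finset.Ico 1 N).biUnion fun m =>
      (((Finset.univ : Finset V).powersetCard m).filter fun T =>
        k * m ≤ (edgesIn G T).card).biUnion Finset.powerset
    have hle := betti_le_finrank_of_le _ k (Finsupp.supported ℚ ℚ (A : Set (Finset V)))
      ((cycles_le_boundaries_sup G hkN h).trans (sup_le_sup_left (Finsupp.supported_mono ?_) _))
    · rw [finrank_supported] at hle
      refine hle.trans (Finset.card_biUnion_le.trans (Finset.sum_le_sum fun m _ => ?_))
      rw [← Finset.sum_filter]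
      refine Finset.card_biUnion_le.trans (Finset.sum_le_sum fun T hT => ?_)
      rw [Finset.card_powerset, (Finset.mem_powersetCard.1 (Finset.mem_filter.1 hT).1).2]
    · rintro s ⟨T, ⟨hne, hlt, he⟩, hs⟩
      exact Finset.mem_coe.2 (Finset.mem_biUnion.2 ⟨T.card,
        Finset.mem_Ico.2 ⟨hne.card_pos, hlt⟩, Finset.mem_biUnion.2 ⟨T, Finset.mem_filter.2
        ⟨Finset.mem_powersetCard.2 ⟨Finset.subset_univ _, rfl⟩, he⟩, Finset.mem_powerset.2 hs⟩⟩)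

end Betti

/-! ### First moments in the binomial random graph -/

section Probability

open SimpleGraph unitInterval

variable {V : Type*} [Fintype V]

instance : MeasurableSingletonClass (SimpleGraph V) where
  measurableSet_singleton G := by
    have h := measurable_edgeSet (MeasurableSet.singleton G.edgeSet)
    rwa [← Set.image_singleton, Set.preimage_image_eq _ edgeSet_injective] at h

theorem binomialRandom_subset_edgeSet_le (p : I) (F : Finset (Sym2 V)) :
    (binomialRandom V p).real {G | (F : Set (Sym2 V)) ⊆ G.edgeSet} ≤ (p : ℝ) ^ F.card := by
  have h : binomialRandom V p {G | (F : Set (Sym2 V)) ⊆ G.edgeSet} ≤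
      (toNNReal p : ENNReal) ^ F.card := by
    rw [binomialRandom_apply]
    refine (measure_mono (t := Set.pi (F : Set (Sym2 V)) fun _ => {q | q}) ?_).trans ?_
    · rintro _ ⟨G, hG, rfl⟩ e he
      exact hG he
    · rw [Measure.infinitePi_pi _ (fun _ _ => .of_discrete), ← Finset.prod_const]
      refine Finset.prod_le_prod' fun e _ => ?_
      by_cases he : e.IsDiag <;> simp [he, Set.indicator]
  rw [measureReal_def]
  refine (ENNReal.toReal_mono (by finiteness) h).trans ?_
  simp

theorem binomialRandom_card_edgesIn_le [DecidableEq V] (p : I) (T : Finset V) (e : ℕ)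
    [∀ G : SimpleGraph V, DecidableRel G.Adj] :
    (binomialRandom V p).real {G | e ≤ (edgesIn G T).card} ≤
      2 ^ (T.card + 1).choose 2 * (p : ℝ) ^ e := by
  -- A union bound over the possible sets of `e` edges inside `T`.
  have hsub : {G : SimpleGraph V | e ≤ (edgesIn G T).card} ⊆
      ⋃ F ∈ T.sym2.powersetCard e, {G : SimpleGraph V | (F : Set (Sym2 V)) ⊆ G.edgeSet} := by
    intro G hG
    obtain ⟨F, hF, hFe⟩ := Finset.exists_subset_card_eq (Set.mem_ofPred_eq ▸ hG)
    refine Set.mem_biUnion (x := F) (Finset.mem_coe.2 (Finset.mem_powersetCard.2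
      ⟨hF.trans (Finset.filter_subset _ _), hFe⟩)) fun x hx => ?_
    exact (Finset.mem_filter.1 (hF hx)).2
  calc _ ≤ _ := measureReal_mono hsub (measure_ne_top _ _)
    _ ≤ _ := measureReal_biUnion_finset_le _ _
    _ ≤ ∑ F ∈ T.sym2.powersetCard e, (p : ℝ) ^ e := Finset.sum_le_sum fun F hF => by
        rw [← (Finset.mem_powersetCard.1 hF).2]
        exact binomialRandom_subset_edgeSet_le p F
    _ ≤ _ := by
        rw [Finset.sum_const, nsmul_eq_mul, ← Finset.card_sym2]
        refine mul_le_mul_of_nonneg_right ?_ (by have := p.2.1; positivity)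
        rw [Finset.card_powersetCard]
        exact_mod_cast Nat.choose_le_two_pow _ _

theorem integrable_binomialRandom (p : I) (f : SimpleGraph V → ℝ) :
    Integrable f (binomialRandom V p) :=
  Integrable.of_finite

/-- First moment bound: the expected number of `m`-sets spanning at least `e` edges, each counted
with weight `c`. -/
theorem integral_sum_ite_le [DecidableEq V] (p : I) (m e : ℕ) {c : ℝ} (hc : 0 ≤ c)
    [∀ G : SimpleGraph V, DecidableRel G.Adj] :
    ∫ G : SimpleGraph V, ∑ T ∈ (Finset.univ : Finset V).powersetCard m,
      (if e ≤ (edgesIn G T).card then c else 0) ∂(binomialRandom V p) ≤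
      2 ^ (m + 1).choose 2 * c * ((Fintype.card V : ℝ) ^ m * (p : ℝ) ^ e) := by
  have hp : (0 : ℝ) ≤ p := p.2.1
  rw [integral_finsetSum _ fun _ _ => integrable_binomialRandom _ _]
  calc _ ≤ ∑ T ∈ (Finset.univ : Finset V).powersetCard m, 2 ^ (m + 1).choose 2 * (p : ℝ) ^ e * c :=
        Finset.sum_le_sum fun T hT => by
          have : (fun G : SimpleGraph V => if e ≤ (edgesIn G T).card then c else 0) =
              Set.indicator {G | e ≤ (edgesIn G T).card} fun _ => c := by
            ext G; simp [Set.indicator]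
          rw [this, integral_indicator .of_discrete, setIntegral_const, smul_eq_mul,
            ← (Finset.mem_powersetCard.1 hT).2]
          exact mul_le_mul_of_nonneg_right (binomialRandom_card_edgesIn_le p T e) hc
    _ ≤ _ := by
        rw [Finset.sum_const, Finset.card_powersetCard, Finset.card_univ, nsmul_eq_mul]
        have : ((Fintype.card V).choose m : ℝ) ≤ (Fintype.card V : ℝ) ^ m := by
          exact_mod_cast Nat.choose_le_pow _ _
        calc _ ≤ (Fintype.card V : ℝ) ^ m * (2 ^ (m + 1).choose 2 * (p : ℝ) ^ e * c) :=
              mul_le_mul_of_nonneg_right this (by positivity)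
          _ = _ := by ring

theorem integral_betti_le [LinearOrder V] (p : I) {k N : ℕ} (hkN : k + 1 ≤ N) :
    ∫ G : SimpleGraph V, (betti (cliqueComplex G) k : ℝ) ∂(binomialRandom V p) ≤
      ∑ m ∈ Finset.Ico 1 N,
        2 ^ (m + 1).choose 2 * 2 ^ m * ((Fintype.card V : ℝ) ^ m * (p : ℝ) ^ (k * m)) +
      2 ^ (N + 1).choose 2 * (Fintype.card V : ℝ) ^ (k + 1) *
        ((Fintype.card V : ℝ) ^ N * (p : ℝ) ^ (k * N - k * (k + 1))) := by
  classical
  calc _ ≤ ∫ G : SimpleGraph V, ((∑ m ∈ Finset.Ico 1 N,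
          ∑ T ∈ (Finset.univ : Finset V).powersetCard m,
            (if k * m ≤ (edgesIn G T).card then (2 : ℝ) ^ m else 0)) +
          ∑ T ∈ (Finset.univ : Finset V).powersetCard N,
            (if k * N - k * (k + 1) ≤ (edgesIn G T).card then
              (Fintype.card V : ℝ) ^ (k + 1) else 0)) ∂(binomialRandom V p) := by
        refine integral_mono (integrable_binomialRandom _ _) (integrable_binomialRandom _ _)
          fun G => ?_
        have := betti_cliqueComplex_le G hkN
        simp only
        exact_mod_cast this
    _ ≤ _ := by
        rw [integral_add (integrable_binomialRandom _ _) (integrable_binomialRandom _ _),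
          integral_finsetSum _ fun _ _ => integrable_binomialRandom _ _]
        exact add_le_add (Finset.sum_le_sum fun m _ => integral_sum_ite_le p m _ (by positivity))
          (integral_sum_ite_le p N _ (by positivity))

end Probability

/-! ### Asymptotics -/

section Asymptotics

/-- The expected number of copies of a graph with `a` vertices and `b` edges is of order
`n ^ (a - α * b)`, which vanishes when `a < α * b`. -/
theorem tendsto_pow_mul_rpow_pow {α : ℝ} {a b : ℕ} (h : (a : ℝ) < α * b) :
    Tendsto (fun n : ℕ => (n : ℝ) ^ a * ((n : ℝ) ^ (-α)) ^ b) atTop (nhds 0) := by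
  have h1 := (tendsto_rpow_neg_atTop (sub_pos.2 h)).comp tendsto_natCast_atTop_atTop
  refine h1.congr' ?_
  filter_upwards [eventually_gt_atTop 0] with n hn
  have hn' : (0 : ℝ) < n := by exact_mod_cast hn
  rw [Function.comp_apply, ← Real.rpow_natCast, ← Real.rpow_mul_natCast hn'.le,
    ← Real.rpow_add hn']
  congr 1
  ring

/-- A size `N` at which even the factor `n ^ (k + 1)`, which bounds the Betti number, and the deficit
of `k * (k + 1)` edges do not prevent the expectation from vanishing. -/
theorem exists_threshold {α : ℝ} {k : ℕ} (h : 1 < α * k) :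
    ∃ N, k + 1 ≤ N ∧ ((k + 1 + N : ℕ) : ℝ) < α * (k * N - k * (k + 1) : ℕ) := by
  obtain ⟨M, hM⟩ := exists_nat_gt (((k + 1 : ℝ) + α * (k * (k + 1))) / (α * k - 1))
  have hlt := (div_lt_iff₀ (sub_pos.2 h)).1 hM
  refine ⟨max M (k + 1), le_max_right _ _, ?_⟩
  have hM' : (M : ℝ) ≤ (max M (k + 1) : ℕ) := by exact_mod_cast le_max_left _ _
  have hk : k * (k + 1) ≤ k * max M (k + 1) := Nat.mul_le_mul_left _ (le_max_right _ _)
  generalize max M (k + 1) = N at *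
  have := mul_le_mul_of_nonneg_right hM' (sub_pos.2 h).le
  push_cast [Nat.cast_sub hk]
  linarith

end Asymptotics

end RandomClique

theorem lemma3 (d : ℕ) (α : ℝ) (hα : 1 / ((d : ℝ) + 1) < α)
    (p : ℕ → unitInterval) (hp : ∀ n : ℕ, 1 ≤ n → (p n : ℝ) = (n : ℝ) ^ (-α)) :
    (∀ n : ℕ, Integrable
      (fun G : SimpleGraph (Fin n) =>
        (RandomClique.betti (RandomClique.cliqueComplex G) (d + 1) : ℝ))
      (SimpleGraph.binomialRandom (Fin n) (p n))) ∧
    (fun n : ℕ =>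
      ∫ G : SimpleGraph (Fin n),
        (RandomClique.betti (RandomClique.cliqueComplex G) (d + 1) : ℝ)
        ∂(SimpleGraph.binomialRandom (Fin n) (p n))) =o[atTop] (fun _ : ℕ => (1 : ℝ)) := by
  refine ⟨fun n => RandomClique.integrable_binomialRandom _ _, ?_⟩
  rw [isLittleO_one_iff]
  have hk : 1 < α * (d + 1 : ℕ) := by
    push_cast
    exact (div_lt_iff₀ (by positivity)).1 hα
  generalize d + 1 = k at hk ⊢
  obtain ⟨N, hkN, hN⟩ := RandomClique.exists_threshold hk
  have hlim : Tendsto (fun n : ℕ => ∑ m ∈ Finset.Ico 1 N,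
        2 ^ (m + 1).choose 2 * 2 ^ m * ((n : ℝ) ^ m * ((n : ℝ) ^ (-α)) ^ (k * m)) +
      2 ^ (N + 1).choose 2 *
        ((n : ℝ) ^ (k + 1 + N) * ((n : ℝ) ^ (-α)) ^ (k * N - k * (k + 1)))) atTop (nhds 0) := by
    rw [← add_zero (0 : ℝ)]
    refine Tendsto.add ?_ ?_
    · rw [← Finset.sum_const_zero (M := ℝ) (s := Finset.Ico 1 N)]
      refine tendsto_finsetSum _ fun m hm => ?_
      have hm' : (0 : ℝ) < m := by exact_mod_cast (Finset.mem_Ico.1 hm).1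
      rw [← mul_zero ((2 : ℝ) ^ (m + 1).choose 2 * 2 ^ m)]
      refine (RandomClique.tendsto_pow_mul_rpow_pow ?_).const_mul _
      push_cast
      nlinarith
    · rw [← mul_zero ((2 : ℝ) ^ (N + 1).choose 2)]
      exact (RandomClique.tendsto_pow_mul_rpow_pow hN).const_mul _
  refine squeeze_zero' (Eventually.of_forall fun n => integral_nonneg fun G => Nat.cast_nonneg _) ?_
    hlim
  filter_upwards [eventually_ge_atTop 1] with n hn
  refine (RandomClique.integral_betti_le (p n) hkN).trans_eq ?_
  rw [Fintype.card_fin, hp n hn, pow_add (n : ℝ) (k + 1) N]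
  ring
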